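/- Let $n\ge 0$ be an integer, $0\le h\le T$, $T>0$, and let $A_0,A_1:\mathbb{R}\to\mathbb{R}^{n\times n}$ be continuous and $T$-periodic. Consider the delay system $\dot x(t)=A_0(t)x(t)+A_1(t)x(t-h)$. A function $U\in\mathcal C(\mathbb{R}^2,\mathbb{R}^{n\times n})$ is called a delay Lyapunov matrix of this system associated with $W:\mathbb{R}\to\mathbb{R}^{n\times n}$ if 1. $\dfrac{\partial U(\tau,s)}{\partial\tau}=-A_0^T(\tau)U(\tau,s)-A_1^T(\tau+h)U(\tau+h,s)$ for all $s>\tau$; 2. $U^T(\tau,s)=U(s,\tau)$ for all $\tau,s\in\mathbb{R}$; 3. $\dfrac{\mathrm d U(\tau,\tau)}{\mathrm d\tau}=-A_0^T(\tau)U(\tau,\tau)-A_1^T(\tau+h)U(\tau+h,\tau)-U(\tau,\tau)A_0(\tau)-U(\tau,\tau+h)A_1(\tau+h)-W(\tau)$ for all $\tau\in\mathbb{R}$; 4. $U(\tau+T,s+T)=U(\tau,s)$ for all $\tau,s\in\mathbb{R}$ (the derivatives being part of the requirement to exist). Let $\mathcal H=\mathbb{C}^n\times L^2([-h,0],\mathbb{C}^n)$,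 with elements $\varphi=(\varphi_0,\Phi)$, let $U$ be a delay Lyapunov matrix of the system associated with $W\equiv 0$, and let $\mathcal P_0:\mathcal H\to\mathcal H$ be the linear operator $$ \mathcal P_0\varphi=\begin{pmatrix} U(0,0)\varphi_0+\int_{-h}^0 U(0,h+\theta)A_1(h+\theta)\Phi(\theta)\,\mathrm d\theta\\ A_1^T(h+\cdot)\left[U(h+\cdot,0)\varphi_0+\int_{-h}^0 U(h+\cdot,h+s)A_1(h+s)\Phi(s)\,\mathrm d s\right] \end{pmatrix}. $$ If $\mathcal P_0\varphi=0$ for all $\varphi\in\mathcal H$, then $U(\theta,s)=0$ for all $\theta,s\in\mathbb{R}$. -/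

import Mathlib

open MeasureTheory
open scoped Matrix

noncomputable section

/-- `U` is a delay Lyapunov matrix, associated with `W`, of the `T`-periodic delay system
`x'(t) = A₀(t) x(t) + A₁(t) x(t - h)`: it is a continuous function of two real variables with
the PDE, symmetry, ODE and periodicity properties. -/
structure IsDelayLyapunovMatrix {n : ℕ} (A₀ A₁ : ℝ → Matrix (Fin n) (Fin n) ℝ) (h T : ℝ)
    (W : ℝ → Matrix (Fin n) (Fin n) ℝ) (U : ℝ → ℝ → Matrix (Fin n) (Fin n) ℝ) : Prop where
  continuous : Continuous fun p : ℝ × ℝ => U p.1 p.2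
  pde : ∀ τ s : ℝ, τ < s → HasDerivAt (fun σ => U σ s)
    (-((A₀ τ)ᵀ * U τ s) - (A₁ (τ + h))ᵀ * U (τ + h) s) τ
  symm : ∀ τ s : ℝ, (U τ s)ᵀ = U s τ
  ode : ∀ τ : ℝ, HasDerivAt (fun σ => U σ σ)
    (-((A₀ τ)ᵀ * U τ τ) - (A₁ (τ + h))ᵀ * U (τ + h) τ
      - U τ τ * A₀ τ - U τ (τ + h) * A₁ (τ + h) - W τ) τ
  periodic : ∀ τ s : ℝ, U (τ + T) (s + T) = U τ s

/-- Lebesgue measure on the interval `[-h, 0]`. -/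
abbrev delayMeasure (h : ℝ) : Measure ℝ := volume.restrict (Set.Icc (-h) 0)

/-- The Hilbert space `ℂⁿ × L²([-h, 0], ℂⁿ)` with the inner product
`φ₀⋆ ψ₀ + ∫_{-h}^0 Φ(θ)⋆ Ψ(θ) dθ`. -/
abbrev DelayStateSpace (n : ℕ) (h : ℝ) : Type :=
  WithLp 2 (EuclideanSpace ℂ (Fin n) × Lp (EuclideanSpace ℂ (Fin n)) 2 (delayMeasure h))

/-- The action of a real `n × n` matrix on `ℂⁿ`. -/
def complexAction {n : ℕ} (M : Matrix (Fin n) (Fin n) ℝ) :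
    EuclideanSpace ℂ (Fin n) →L[ℂ] EuclideanSpace ℂ (Fin n) :=
  Matrix.toEuclideanCLM (n := Fin n) (𝕜 := ℂ) (M.map Complex.ofReal)

theorem continuous_complexAction {n : ℕ} :
    Continuous (complexAction : Matrix (Fin n) (Fin n) ℝ → _) := by
  have h1 : Continuous (Matrix.toEuclideanCLM (n := Fin n) (𝕜 := ℂ)) :=
    LinearMap.continuous_of_finiteDimensional
      (Matrix.toEuclideanCLM (n := Fin n) (𝕜 := ℂ)).toAlgEquiv.toLinearMap
  exact h1.comp (continuous_id.matrix_map Complex.continuous_ofReal)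

/-- The integral `∫_{-h}^0 U(a, h + s) A₁(h + s) Φ(s) ds`. -/
def lyapunovIntegral {n : ℕ} (A₁ : ℝ → Matrix (Fin n) (Fin n) ℝ) (h : ℝ)
    (U : ℝ → ℝ → Matrix (Fin n) (Fin n) ℝ)
    (Φ : Lp (EuclideanSpace ℂ (Fin n)) 2 (delayMeasure h)) (a : ℝ) :
    EuclideanSpace ℂ (Fin n) :=
  ∫ s in Set.Icc (-h) 0, complexAction (U a (h + s) * A₁ (h + s)) (Φ s)

/-- The second component of `P₀ φ` as a function of `θ`, namely
`A₁(h + θ)ᵀ [U(h + θ, 0) φ₀ + ∫_{-h}^0 U(h + θ, h + s) A₁(h + s) Φ(s) ds]`. -/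
def lyapunovSnd {n : ℕ} (A₁ : ℝ → Matrix (Fin n) (Fin n) ℝ) (h : ℝ)
    (U : ℝ → ℝ → Matrix (Fin n) (Fin n) ℝ) (φ : DelayStateSpace n h) (θ : ℝ) :
    EuclideanSpace ℂ (Fin n) :=
  complexAction (A₁ (h + θ))ᵀ
    (complexAction (U (h + θ) 0) φ.fst + lyapunovIntegral A₁ h U φ.snd (h + θ))

section Regularity

variable {n : ℕ} {A₁ : ℝ → Matrix (Fin n) (Fin n) ℝ} {U : ℝ → ℝ → Matrix (Fin n) (Fin n) ℝ}

theorem continuous_lyapunovKernel (h : ℝ) (hA₁ : Continuous A₁)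
    (hU : Continuous fun p : ℝ × ℝ => U p.1 p.2) :
    Continuous fun p : ℝ × ℝ => complexAction (U p.1 (h + p.2) * A₁ (h + p.2)) := by
  refine continuous_complexAction.comp (Continuous.matrix_mul ?_ (by fun_prop))
  exact hU.comp (by fun_prop : Continuous fun p : ℝ × ℝ => (p.1, h + p.2))

theorem aestronglyMeasurable_lyapunovIntegrand (h : ℝ) (hA₁ : Continuous A₁)
    (hU : Continuous fun p : ℝ × ℝ => U p.1 p.2)
    (Φ : Lp (EuclideanSpace ℂ (Fin n)) 2 (delayMeasure h)) (a : ℝ) :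
    AEStronglyMeasurable (fun s => complexAction (U a (h + s) * A₁ (h + s)) (Φ s))
      (delayMeasure h) := by
  have hp : Continuous fun s : ℝ => U a (h + s) :=
    hU.comp (by fun_prop : Continuous fun s : ℝ => (a, h + s))
  have hc : Continuous fun s : ℝ => complexAction (U a (h + s) * A₁ (h + s)) :=
    continuous_complexAction.comp (hp.matrix_mul (by fun_prop))
  have happ : Continuous fun p : (EuclideanSpace ℂ (Fin n) →L[ℂ] EuclideanSpace ℂ (Fin n)) ×
      EuclideanSpace ℂ (Fin n) => p.1 p.2 := continuous_fst.clm_apply continuous_snd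
  have h1 : AEStronglyMeasurable (fun s : ℝ => complexAction (U a (h + s) * A₁ (h + s)))
      (delayMeasure h) := hc.aestronglyMeasurable
  exact happ.comp_aestronglyMeasurable (h1.prodMk (Lp.aestronglyMeasurable Φ))

theorem lyapunovIntegrand_bound (h : ℝ) (hA₁ : Continuous A₁)
    (hU : Continuous fun p : ℝ × ℝ => U p.1 p.2)
    (Φ : Lp (EuclideanSpace ℂ (Fin n)) 2 (delayMeasure h)) (a b : ℝ) :
    ∃ C : ℝ, ∀ x ∈ Set.Icc a b, ∀ᵐ s ∂(delayMeasure h),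
      ‖complexAction (U x (h + s) * A₁ (h + s)) (Φ s)‖ ≤ C * ‖Φ s‖ := by
  obtain ⟨C, hC⟩ := ((isCompact_Icc (a := a) (b := b)).prod
    (isCompact_Icc (a := -h) (b := (0 : ℝ)))).exists_bound_of_continuousOn
    (continuous_lyapunovKernel h hA₁ hU).continuousOn
  refine ⟨C, fun x hx => (ae_restrict_iff' measurableSet_Icc).2 (.of_forall fun s hs => ?_)⟩
  exact (ContinuousLinearMap.le_opNorm _ _).trans
    (mul_le_mul_of_nonneg_right (hC (x, s) ⟨hx, hs⟩) (norm_nonneg _))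

theorem integrable_Lp_delayMeasure (h : ℝ)
    (Φ : Lp (EuclideanSpace ℂ (Fin n)) 2 (delayMeasure h)) :
    Integrable Φ (delayMeasure h) :=
  (Lp.memLp Φ).integrable (by norm_num)

theorem integrable_lyapunovIntegrand (h : ℝ) (hA₁ : Continuous A₁)
    (hU : Continuous fun p : ℝ × ℝ => U p.1 p.2)
    (Φ : Lp (EuclideanSpace ℂ (Fin n)) 2 (delayMeasure h)) (a : ℝ) :
    Integrable (fun s => complexAction (U a (h + s) * A₁ (h + s)) (Φ s)) (delayMeasure h) := by
  obtain ⟨C, hC⟩ := lyapunovIntegrand_bound h hA₁ hU Φ a a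
  exact ((integrable_Lp_delayMeasure h Φ).norm.const_mul C).mono'
    (aestronglyMeasurable_lyapunovIntegrand h hA₁ hU Φ a) (hC a (by simp))

theorem lyapunovIntegral_add (h : ℝ) (hA₁ : Continuous A₁)
    (hU : Continuous fun p : ℝ × ℝ => U p.1 p.2)
    (Φ Ψ : Lp (EuclideanSpace ℂ (Fin n)) 2 (delayMeasure h)) (a : ℝ) :
    lyapunovIntegral A₁ h U (Φ + Ψ) a
      = lyapunovIntegral A₁ h U Φ a + lyapunovIntegral A₁ h U Ψ a := by
  unfold lyapunovIntegral
  rw [← integral_add (integrable_lyapunovIntegrand h hA₁ hU Φ a)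
    (integrable_lyapunovIntegrand h hA₁ hU Ψ a)]
  refine integral_congr_ae ?_
  filter_upwards [Lp.coeFn_add Φ Ψ] with s hs
  rw [hs, Pi.add_apply, map_add]

theorem lyapunovIntegral_smul (h : ℝ) (c : ℂ)
    (Φ : Lp (EuclideanSpace ℂ (Fin n)) 2 (delayMeasure h)) (a : ℝ) :
    lyapunovIntegral A₁ h U (c • Φ) a = c • lyapunovIntegral A₁ h U Φ a := by
  unfold lyapunovIntegral
  rw [← integral_smul]
  refine integral_congr_ae ?_
  filter_upwards [Lp.coeFn_smul c Φ] with s hs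
  rw [hs, Pi.smul_apply, map_smul]

theorem continuous_lyapunovIntegral (h : ℝ) (hA₁ : Continuous A₁)
    (hU : Continuous fun p : ℝ × ℝ => U p.1 p.2)
    (Φ : Lp (EuclideanSpace ℂ (Fin n)) 2 (delayMeasure h)) :
    Continuous (lyapunovIntegral A₁ h U Φ) := by
  refine continuous_iff_continuousAt.2 fun x => ?_
  obtain ⟨C, hC⟩ := lyapunovIntegrand_bound h hA₁ hU Φ (x - 1) (x + 1)
  have hF : ∀ s : ℝ, Continuous fun a : ℝ =>
      complexAction (U a (h + s) * A₁ (h + s)) (Φ s) := fun s =>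
    ((continuous_lyapunovKernel h hA₁ hU).comp
      (by fun_prop : Continuous fun a : ℝ => (a, s))).clm_apply continuous_const
  have : ContinuousOn (lyapunovIntegral A₁ h U Φ) (Set.Icc (x - 1) (x + 1)) :=
    continuousOn_of_dominated
      (fun a _ => aestronglyMeasurable_lyapunovIntegrand h hA₁ hU Φ a) hC
      ((integrable_Lp_delayMeasure h Φ).norm.const_mul C)
      (.of_forall fun s => (hF s).continuousOn)
  exact this.continuousAt (Icc_mem_nhds (by linarith) (by linarith))

theorem continuous_lyapunovSnd (h : ℝ) (hA₁ : Continuous A₁)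
    (hU : Continuous fun p : ℝ × ℝ => U p.1 p.2) (φ : DelayStateSpace n h) :
    Continuous (lyapunovSnd A₁ h U φ) := by
  have h1 : Continuous fun θ : ℝ => complexAction (A₁ (h + θ))ᵀ :=
    continuous_complexAction.comp
      (hA₁.comp (by fun_prop : Continuous fun θ : ℝ => h + θ)).matrix_transpose
  have h2 : Continuous fun θ : ℝ => complexAction (U (h + θ) 0) :=
    continuous_complexAction.comp
      (hU.comp (by fun_prop : Continuous fun θ : ℝ => (h + θ, (0 : ℝ))))
  exact h1.clm_apply ((h2.clm_apply continuous_const).add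
    ((continuous_lyapunovIntegral h hA₁ hU φ.snd).comp (by fun_prop)))

theorem memLp_lyapunovSnd (h : ℝ) (hA₁ : Continuous A₁)
    (hU : Continuous fun p : ℝ × ℝ => U p.1 p.2) (φ : DelayStateSpace n h) :
    MemLp (lyapunovSnd A₁ h U φ) 2 (delayMeasure h) := by
  have hc := continuous_lyapunovSnd h hA₁ hU φ
  obtain ⟨C, hC⟩ := (isCompact_Icc (a := -h) (b := (0 : ℝ))).exists_bound_of_continuousOn
    hc.continuousOn
  exact MemLp.of_bound hc.aestronglyMeasurable C
    ((ae_restrict_iff' measurableSet_Icc).2 (.of_forall hC))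

end Regularity

/-- The linear operator `P₀` on `ℂⁿ × L²([-h, 0], ℂⁿ)`, whose value at `φ = (φ₀, Φ)` has first
component `U(0, 0) φ₀ + ∫_{-h}^0 U(0, h + θ) A₁(h + θ) Φ(θ) dθ` and second component
`A₁(h + ·)ᵀ [U(h + ·, 0) φ₀ + ∫_{-h}^0 U(h + ·, h + s) A₁(h + s) Φ(s) ds]`. -/
def lyapunovOperator {n : ℕ} (A₁ : ℝ → Matrix (Fin n) (Fin n) ℝ) (h : ℝ)
    (U : ℝ → ℝ → Matrix (Fin n) (Fin n) ℝ) (hA₁ : Continuous A₁)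
    (hU : Continuous fun p : ℝ × ℝ => U p.1 p.2) :
    DelayStateSpace n h →ₗ[ℂ] DelayStateSpace n h where
  toFun φ := WithLp.toLp 2
    (complexAction (U 0 0) φ.fst + lyapunovIntegral A₁ h U φ.snd 0,
      (memLp_lyapunovSnd h hA₁ hU φ).toLp (lyapunovSnd A₁ h U φ))
  map_add' φ ψ := by
    refine (WithLp.ofLp_injective 2) (Prod.ext ?_ ?_)
    · simp only [WithLp.ofLp_add, Prod.fst_add, WithLp.add_fst, WithLp.add_snd, map_add,
        lyapunovIntegral_add h hA₁ hU]
      abel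
    · have hs : lyapunovSnd A₁ h U (φ + ψ)
          = lyapunovSnd A₁ h U φ + lyapunovSnd A₁ h U ψ := by
        funext θ
        simp only [lyapunovSnd, WithLp.add_fst, WithLp.add_snd, map_add, Pi.add_apply,
          lyapunovIntegral_add h hA₁ hU]
        abel
      simp only [WithLp.ofLp_add, Prod.snd_add, hs]
      exact MemLp.toLp_add _ _
  map_smul' c φ := by
    refine (WithLp.ofLp_injective 2) (Prod.ext ?_ ?_)
    · simp only [RingHom.id_apply, WithLp.ofLp_smul, Prod.smul_fst, WithLp.smul_fst,
        WithLp.smul_snd, map_smul, lyapunovIntegral_smul, smul_add]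
    · have hs : lyapunovSnd A₁ h U (c • φ) = c • lyapunovSnd A₁ h U φ := by
        funext θ
        simp only [lyapunovSnd, WithLp.smul_fst, WithLp.smul_snd, map_smul, Pi.smul_apply,
          lyapunovIntegral_smul, smul_add, map_add]
      simp only [RingHom.id_apply, WithLp.ofLp_smul, Prod.smul_snd, hs]
      exact MemLp.toLp_const_smul _ _

end

/-! ### Backward uniqueness for linear matrix equations -/

section LinearODE

open scoped Matrix.Norms.Operator

/-! Testing the operator on `(v, 0)` and on `(0, 1_S v)` shows that `U 0 0`, `(A₁ a)ᵀ * U a 0` and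
`(A₁ a)ᵀ * U a b * A₁ b` vanish for `a`, `b` in `[0, h]`. These are the data that drive the
equations for `U` backward from `0`: the values of `U` at positive arguments enter only through the
delay term, always multiplied by `A₁`.

For `h > 0`, the method of steps (`eq_zero_of_delay_ode`) first removes the right factor `A₁ b`;
then `eq_zero_of_delay_pos` fills the squares `[-kh, 0]²` by induction, using homogeneous linear
equations along columns and along the diagonal. For `h = 0` the equations have no delay. Periodicity
carries the result from nonpositive arguments to the whole plane. -/

theorem matrix_eq_zero_of_linear_ode {n : ℕ} {P Q F : ℝ → Matrix (Fin n) (Fin n) ℝ} {a b : ℝ}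
    (hP : Continuous P) (hQ : Continuous Q) (hF : Continuous F) (hb : F b = 0)
    (hd : ∀ t ∈ Set.Ioo a b, HasDerivAt F (P t * F t + F t * Q t) t) :
    ∀ t ∈ Set.Icc a b, F t = 0 := by
  intro t ht
  rcases ht.2.eq_or_lt with rfl | htb
  · exact hb
  have hab : a < b := ht.1.trans_lt htb
  obtain ⟨C, hC⟩ := (isCompact_Icc (a := a) (b := b)).exists_bound_of_continuousOn
    hP.continuousOn
  obtain ⟨D, hD⟩ := (isCompact_Icc (a := a) (b := b)).exists_bound_of_continuousOn
    hQ.continuousOn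
  have hC0 : 0 ≤ C := (norm_nonneg _).trans (hC a (Set.left_mem_Icc.2 hab.le))
  have hD0 : 0 ≤ D := (norm_nonneg _).trans (hD a (Set.left_mem_Icc.2 hab.le))
  have hder : ∀ t ∈ Set.Ioc a b, HasDerivWithinAt F (P t * F t + F t * Q t) (Set.Iic t) t := by
    intro t ht
    rcases ht.2.eq_or_lt with rfl | htb
    -- At the endpoint the left derivative is the limit of the derivatives. No equation is assumed
    -- there: the equation for a column of `U` stops short of the diagonal.
    · refine hasDerivWithinAt_Iic_of_tendsto_deriv (s := Set.Ioo a t)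
        (fun x hx => (hd x hx).differentiableAt.differentiableWithinAt)
        hF.continuousWithinAt (Ioo_mem_nhdsLT hab) ?_
      have hc : Continuous fun t => P t * F t + F t * Q t := by fun_prop
      refine ((hc.tendsto t).mono_left nhdsWithin_le_nhds).congr' ?_
      filter_upwards [Ioo_mem_nhdsLT hab] with x hx
      exact (hd x hx).deriv.symm
    · exact (hd t ⟨ht.1, htb⟩).hasDerivWithinAt
  have key := ODE_solution_unique_of_mem_Icc_left (v := fun t X => P t * X + X * Q t)
    (s := fun _ => Set.univ) (K := ⟨C + D, add_nonneg hC0 hD0⟩) (f := F) (g := fun _ => 0)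
    (a := a) (b := b) ?_ hF.continuousOn hder (fun _ _ => trivial) continuousOn_const ?_
    (fun _ _ => trivial) hb
  · exact key ht
  · intro t ht
    refine LipschitzOnWith.of_dist_le_mul fun X _ Y _ => ?_
    have ht' := Set.Ioc_subset_Icc_self ht
    rw [dist_eq_norm, dist_eq_norm]
    have : P t * X + X * Q t - (P t * Y + Y * Q t) = P t * (X - Y) + (X - Y) * Q t := by
      noncomm_ring
    rw [this]
    calc _ ≤ ‖P t‖ * ‖X - Y‖ + ‖X - Y‖ * ‖Q t‖ :=
          (norm_add_le _ _).trans (add_le_add (norm_mul_le _ _) (norm_mul_le _ _))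
      _ ≤ C * ‖X - Y‖ + ‖X - Y‖ * D := by
          gcongr
          exacts [hC t ht', hD t ht']
      _ = (C + D) * ‖X - Y‖ := by ring
  · intro t _
    simpa using hasDerivWithinAt_const t (Set.Iic t) (0 : Matrix (Fin n) (Fin n) ℝ)

/-- The product rule uses the operator norm, which is open only in this section. -/
theorem hasDerivAt_matrix_mul_const {n : ℕ} {F : ℝ → Matrix (Fin n) (Fin n) ℝ}
    {F' : Matrix (Fin n) (Fin n) ℝ} {t : ℝ} (hF : HasDerivAt F F' t)
    (M : Matrix (Fin n) (Fin n) ℝ) : HasDerivAt (fun σ => F σ * M) (F' * M) t :=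
  hF.mul_const M

end LinearODE

/-- Method of steps, run backward: the delayed term vanishes on the first step by `hfirst`, and on
later steps because `F` is already zero one step to the right. -/
theorem eq_zero_of_delay_ode {n : ℕ} {A₀ A₁ F : ℝ → Matrix (Fin n) (Fin n) ℝ} {h c : ℝ}
    (hh : 0 < h) (hA₀ : Continuous A₀) (hF : Continuous F) (hc : F c = 0)
    (hd : ∀ t < c, HasDerivAt F (-((A₀ t)ᵀ * F t) - (A₁ (t + h))ᵀ * F (t + h)) t)
    (hfirst : ∀ t ∈ Set.Ico (c - h) c, (A₁ (t + h))ᵀ * F (t + h) = 0) :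
    ∀ t ≤ c, F t = 0 := by
  have key : ∀ k : ℕ, ∀ t ∈ Set.Icc (c - k * h) c, F t = 0 := by
    intro k
    induction k with
    | zero =>
      intro t ht
      have : t = c := le_antisymm ht.2 (by simpa using ht.1)
      rw [this, hc]
    | succ k ih =>
      refine matrix_eq_zero_of_linear_ode (P := fun t => -(A₀ t)ᵀ) (Q := fun _ => 0)
        hA₀.matrix_transpose.neg continuous_const hF hc fun t ht => ?_
      have hz : (A₁ (t + h))ᵀ * F (t + h) = 0 := by
        rcases le_or_gt (c - h) t with h1 | h1
        · exact hfirst t ⟨h1, ht.2⟩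
        · rw [ih (t + h) ⟨?_, by linarith⟩, mul_zero]
          have := ht.1
          push_cast at this
          linarith
      have := hd t ht.2
      rw [hz] at this
      simpa using this
  intro t ht
  obtain ⟨k, hk⟩ := exists_nat_ge ((c - t) / h)
  rw [div_le_iff₀ hh] at hk
  exact key k t ⟨by linarith, ht⟩

/-! ### Propagation of zeros of `U` -/

namespace IsDelayLyapunovMatrix

variable {n : ℕ} {A₀ A₁ : ℝ → Matrix (Fin n) (Fin n) ℝ} {h T : ℝ}
  {W : ℝ → Matrix (Fin n) (Fin n) ℝ} {U : ℝ → ℝ → Matrix (Fin n) (Fin n) ℝ}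

theorem continuous_left (hU : IsDelayLyapunovMatrix A₀ A₁ h T W U) (s : ℝ) :
    Continuous fun σ => U σ s :=
  hU.continuous.comp (by fun_prop : Continuous fun σ : ℝ => (σ, s))

theorem continuous_diag (hU : IsDelayLyapunovMatrix A₀ A₁ h T W U) :
    Continuous fun σ => U σ σ :=
  hU.continuous.comp (by fun_prop : Continuous fun σ : ℝ => (σ, σ))

theorem eq_zero_symm (hU : IsDelayLyapunovMatrix A₀ A₁ h T W U) {τ s : ℝ} (hz : U τ s = 0) :
    U s τ = 0 := by
  rw [← hU.symm, hz, Matrix.transpose_zero]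

theorem eq_zero_of_column (hU : IsDelayLyapunovMatrix A₀ A₁ h T W U) (hA₀ : Continuous A₀)
    {a b s : ℝ} (hbs : b ≤ s) (hb : U b s = 0)
    (hz : ∀ t ∈ Set.Ioo a b, (A₁ (t + h))ᵀ * U (t + h) s = 0) :
    ∀ t ∈ Set.Icc a b, U t s = 0 := by
  refine matrix_eq_zero_of_linear_ode (P := fun t => -(A₀ t)ᵀ) (Q := fun _ => 0)
    hA₀.matrix_transpose.neg continuous_const (hU.continuous_left s) hb fun t ht => ?_
  have := hU.pde t s (ht.2.trans_le hbs)
  rw [hz t ht] at this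
  simpa using this

/-- The two delay terms are transposes of each other, so `hz` removes both; with `W = 0` a
homogeneous Lyapunov equation remains. -/
theorem diag_eq_zero (hU : IsDelayLyapunovMatrix A₀ A₁ h T (fun _ => 0) U)
    (hA₀ : Continuous A₀) {a b : ℝ} (hb : U b b = 0)
    (hz : ∀ t ∈ Set.Ioo a b, (A₁ (t + h))ᵀ * U (t + h) t = 0) :
    ∀ t ∈ Set.Icc a b, U t t = 0 := by
  refine matrix_eq_zero_of_linear_ode (P := fun t => -(A₀ t)ᵀ) (Q := fun t => -A₀ t)
    hA₀.matrix_transpose.neg hA₀.neg hU.continuous_diag hb fun t ht => ?_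
  have h2 : U t (t + h) * A₁ (t + h) = 0 := by
    have := congrArg Matrix.transpose (hz t ht)
    rwa [Matrix.transpose_mul, Matrix.transpose_transpose, hU.symm, Matrix.transpose_zero] at this
  have := hU.ode t
  rw [hz t ht, h2] at this
  simpa [sub_eq_add_neg] using this

theorem eq_zero_of_nonpos (hU : IsDelayLyapunovMatrix A₀ A₁ h T W U)
    (hT : 0 < T)
    (hz : ∀ t ≤ 0, ∀ s ≤ 0, U t s = 0) (t s : ℝ) : U t s = 0 := by
  have hper : ∀ k : ℕ, ∀ t s : ℝ, U (t - k * T) (s - k * T) = U t s := by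
    intro k
    induction k with
    | zero => simp
    | succ k ih =>
      intro t s
      rw [← ih t s, ← hU.periodic]
      push_cast
      congr 1 <;> ring
  obtain ⟨k, hk⟩ := exists_nat_ge (max t s / T)
  rw [div_le_iff₀ hT, max_le_iff] at hk
  rw [← hper k]
  exact hz _ (by linarith) _ (by linarith)

/-- Without delay, `A₁` merges with `A₀` and the equations are ordinary: solve back along the
diagonal from `0`, then along each column from the diagonal. -/
theorem eq_zero_of_delay_eq_zero (hU : IsDelayLyapunovMatrix A₀ A₁ 0 T (fun _ => 0) U)
    (hA₀ : Continuous A₀) (hA₁ : Continuous A₁) (h0 : U 0 0 = 0) :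
    ∀ t ≤ 0, ∀ s ≤ 0, U t s = 0 := by
  have hP : Continuous fun t => -(A₀ t)ᵀ - (A₁ t)ᵀ :=
    hA₀.matrix_transpose.neg.sub hA₁.matrix_transpose
  have hdiag : ∀ t ≤ 0, U t t = 0 := fun t ht => by
    refine matrix_eq_zero_of_linear_ode (Q := fun t => -A₀ t - A₁ t) hP (hA₀.neg.sub hA₁)
      hU.continuous_diag h0 (fun t _ => ?_) t ⟨le_rfl, ht⟩
    convert hU.ode t using 1
    simp only [add_zero]
    noncomm_ring
  have hle : ∀ s ≤ 0, ∀ t ≤ s, U t s = 0 := fun s hs t ht => by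
    refine matrix_eq_zero_of_linear_ode (Q := fun _ => 0) hP continuous_const
      (hU.continuous_left s) (hdiag s hs) (fun t ht => ?_) t ⟨le_rfl, ht⟩
    convert hU.pde t s ht.2 using 1
    simp only [add_zero]
    noncomm_ring
  intro t ht s hs
  rcases le_total t s with h1 | h1
  · exact hle s hs t h1
  · exact hU.eq_zero_symm (hle t ht s h1)

theorem eq_zero_of_delay_pos (hU : IsDelayLyapunovMatrix A₀ A₁ h T (fun _ => 0) U)
    (hh : 0 < h) (hA₀ : Continuous A₀) (h0 : U 0 0 = 0)
    (h1 : ∀ a ∈ Set.Icc 0 h, (A₁ a)ᵀ * U a 0 = 0)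
    (h2 : ∀ a ∈ Set.Icc 0 h, ∀ b ∈ Set.Icc 0 h, (A₁ a)ᵀ * U a b * A₁ b = 0) :
    ∀ t ≤ 0, ∀ s ≤ 0, U t s = 0 := by
  -- For fixed `s`, `U t s * A₁ s` solves the delay equation in `t`, with zero value at `0` by `h1`
  -- and zero first-step forcing by `h2`.
  have hA : ∀ s ∈ Set.Icc 0 h, ∀ t ≤ 0, (A₁ s)ᵀ * U s t = 0 := by
    intro s hs t ht
    have hY : U t s * A₁ s = 0 := by
      refine eq_zero_of_delay_ode (A₀ := A₀) (A₁ := A₁) (F := fun t => U t s * A₁ s) hh hA₀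
        ((hU.continuous_left s).matrix_mul continuous_const) ?_ (fun t ht => ?_)
        (fun t ht => ?_) t ht
      · have := congrArg Matrix.transpose (h1 s hs)
        rwa [Matrix.transpose_mul, Matrix.transpose_transpose, hU.symm,
          Matrix.transpose_zero] at this
      · have hd := hasDerivAt_matrix_mul_const (hU.pde t s (ht.trans_le hs.1)) (A₁ s)
        convert hd using 1
        noncomm_ring
      · rw [← mul_assoc]
        exact h2 _ ⟨by linarith [ht.1], by linarith [ht.2]⟩ s hs
    have := congrArg Matrix.transpose hY
    rwa [Matrix.transpose_mul, hU.symm, Matrix.transpose_zero] at this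
  have key : ∀ k : ℕ, ∀ t ∈ Set.Icc (-(k * h)) 0, ∀ s ∈ Set.Icc (-(k * h)) 0, U t s = 0 := by
    intro k
    induction k with
    | zero =>
      intro t ht s hs
      have e1 : t = 0 := le_antisymm ht.2 (by simpa using ht.1)
      have e2 : s = 0 := le_antisymm hs.2 (by simpa using hs.1)
      rw [e1, e2, h0]
    | succ k ih =>
      have e : -(((k + 1 : ℕ) : ℝ) * h) = -(k * h) - h := by push_cast; ring
      rw [e]
      have hkh : 0 ≤ k * h := by positivity
      -- Columns through the old square extend one step left. By symmetry this settles the new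
      -- square except its corner, whose delay terms then vanish too.
      have hstrip : ∀ s ∈ Set.Icc (-(k * h)) 0, ∀ t ∈ Set.Icc (-(k * h) - h) 0, U t s = 0 := by
        intro s hs t ht
        rcases le_total t s with hts | hts
        · refine hU.eq_zero_of_column hA₀ le_rfl (ih s hs s hs) (fun r hr => ?_) t ⟨ht.1, hts⟩
          rcases le_total 0 (r + h) with hr0 | hr0
          · exact hA _ ⟨hr0, by linarith [hr.2, hs.2]⟩ s hs.2
          · rw [ih (r + h) ⟨by linarith [hr.1], hr0⟩ s hs, mul_zero]
        · exact ih t ⟨hs.1.trans hts, ht.2⟩ s hs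
      have hforce : ∀ s ∈ Set.Icc (-(k * h) - h) 0, ∀ r ∈ Set.Icc (-(k * h) - h) 0,
          (A₁ (r + h))ᵀ * U (r + h) s = 0 := by
        intro s hs r hr
        rcases le_total 0 (r + h) with hr0 | hr0
        · exact hA _ ⟨hr0, by linarith [hr.2]⟩ s hs.2
        · rw [hU.eq_zero_symm (hstrip (r + h) ⟨by linarith [hr.1], hr0⟩ s hs), mul_zero]
      have hdiag : ∀ t ∈ Set.Icc (-(k * h) - h) 0, U t t = 0 :=
        hU.diag_eq_zero hA₀ h0 fun t ht =>
          hforce t (Set.Ioo_subset_Icc_self ht) t (Set.Ioo_subset_Icc_self ht)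
      have hle : ∀ s ∈ Set.Icc (-(k * h) - h) 0, ∀ t ∈ Set.Icc (-(k * h) - h) s, U t s = 0 :=
        fun s hs => hU.eq_zero_of_column hA₀ le_rfl (hdiag s hs) fun r hr =>
          hforce s hs r ⟨hr.1.le, hr.2.le.trans hs.2⟩
      intro t ht s hs
      rcases le_total t s with hts | hts
      · exact hle s hs t ⟨ht.1, hts⟩
      · exact hU.eq_zero_symm (hle t ht s ⟨hs.1, hts⟩)
  intro t ht s hs
  obtain ⟨k, hk⟩ := exists_nat_ge (max (-t) (-s) / h)
  rw [div_le_iff₀ hh, max_le_iff] at hk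
  exact key k t ⟨by linarith, ht⟩ s ⟨by linarith, hs⟩

end IsDelayLyapunovMatrix

/-! ### Pointwise identities from the vanishing operator -/

section Extraction

variable {n : ℕ} {A₁ : ℝ → Matrix (Fin n) (Fin n) ℝ} {U : ℝ → ℝ → Matrix (Fin n) (Fin n) ℝ}

theorem eq_zero_of_complexAction_eq_zero {M : Matrix (Fin n) (Fin n) ℝ}
    (hM : ∀ v, complexAction M v = 0) : M = 0 := by
  have h1 : complexAction M = 0 := ContinuousLinearMap.ext hM
  have h2 : M.map Complex.ofReal = 0 :=
    (Matrix.toEuclideanCLM (n := Fin n) (𝕜 := ℂ)).injective (by rw [map_zero]; exact h1)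
  ext i j
  have := congrFun (congrFun h2 i) j
  simpa using this

theorem complexAction_mul (M N : Matrix (Fin n) (Fin n) ℝ) (v : EuclideanSpace ℂ (Fin n)) :
    complexAction (M * N) v = complexAction M (complexAction N v) := by
  unfold complexAction
  have : (M * N).map Complex.ofReal = M.map Complex.ofReal * N.map Complex.ofReal :=
    Matrix.map_mul (f := Complex.ofRealHom)
  rw [this, map_mul]
  rfl

theorem lyapunovIntegral_zero (h a : ℝ) : lyapunovIntegral A₁ h U 0 a = 0 := by
  simpa using lyapunovIntegral_smul (A₁ := A₁) (U := U) h 0 0 a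

variable {h : ℝ} {hA₁ : Continuous A₁} {hU : Continuous fun p : ℝ × ℝ => U p.1 p.2}

theorem eq_zero_of_lyapunovOperator_eq_zero
    (hP : ∀ φ : DelayStateSpace n h, lyapunovOperator A₁ h U hA₁ hU φ = 0) : U 0 0 = 0 := by
  refine eq_zero_of_complexAction_eq_zero fun v => ?_
  have := congrArg WithLp.fst (hP (WithLp.toLp 2 (v, 0)))
  simpa [lyapunovOperator, lyapunovIntegral_zero] using this

/-- Vanishing in `L²` is only almost everywhere; continuity and `h > 0` make it pointwise, endpoints
included. -/
theorem lyapunovSnd_eq_zero (hh : 0 < h)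
    (hP : ∀ φ : DelayStateSpace n h, lyapunovOperator A₁ h U hA₁ hU φ = 0)
    (φ : DelayStateSpace n h) : ∀ θ ∈ Set.Icc (-h) 0, lyapunovSnd A₁ h U φ θ = 0 := by
  have h1 : (memLp_lyapunovSnd h hA₁ hU φ).toLp (lyapunovSnd A₁ h U φ) = 0 :=
    congrArg WithLp.snd (hP φ)
  have h2 : lyapunovSnd A₁ h U φ =ᵐ[delayMeasure h] fun _ => 0 :=
    (MemLp.coeFn_toLp _).symm.trans (h1 ▸ Lp.coeFn_zero _ _ _)
  exact Measure.eqOn_Icc_of_ae_eq (μ := volume) (by linarith : (-h) ≠ 0) h2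
    (continuous_lyapunovSnd h hA₁ hU φ).continuousOn continuousOn_const

theorem transpose_mul_eq_zero_of_lyapunovOperator_eq_zero (hh : 0 < h)
    (hP : ∀ φ : DelayStateSpace n h, lyapunovOperator A₁ h U hA₁ hU φ = 0) :
    ∀ a ∈ Set.Icc 0 h, (A₁ a)ᵀ * U a 0 = 0 := by
  intro a ha
  refine eq_zero_of_complexAction_eq_zero fun v => ?_
  have := lyapunovSnd_eq_zero hh hP (WithLp.toLp 2 (v, 0)) (a - h)
    ⟨by linarith [ha.1], by linarith [ha.2]⟩
  simpa [lyapunovSnd, lyapunovIntegral_zero, complexAction_mul] using this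

theorem transpose_mul_mul_eq_zero_of_lyapunovOperator_eq_zero (hh : 0 < h)
    (hP : ∀ φ : DelayStateSpace n h, lyapunovOperator A₁ h U hA₁ hU φ = 0) :
    ∀ a ∈ Set.Icc 0 h, ∀ b ∈ Set.Icc 0 h, (A₁ a)ᵀ * U a b * A₁ b = 0 := by
  intro a ha b hb
  refine eq_zero_of_complexAction_eq_zero fun v => ?_
  let f : ℝ → EuclideanSpace ℂ (Fin n) :=
    fun s => complexAction ((A₁ a)ᵀ) (complexAction (U a (h + s) * A₁ (h + s)) v)
  have hker : Continuous fun s => complexAction (U a (h + s) * A₁ (h + s)) v :=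
    ((continuous_lyapunovKernel h hA₁ hU).comp
      (by fun_prop : Continuous fun s : ℝ => (a, s))).clm_apply continuous_const
  have hf : Continuous f := (complexAction ((A₁ a)ᵀ)).continuous.comp hker
  have hae : f =ᵐ[delayMeasure h] 0 := by
    -- The test function `1_S v` turns the operator into the integral of `f` over `S`; since `S` is
    -- arbitrary, `f` vanishes almost everywhere, hence on the interval by continuity.
    refine Integrable.ae_eq_zero_of_forall_setIntegral_eq_zero
      (hf.continuousOn.integrableOn_Icc) fun S hS _ => ?_
    have hSμ : delayMeasure h S ≠ ⊤ := measure_ne_top _ _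
    have h1 := lyapunovSnd_eq_zero hh hP
      (WithLp.toLp 2 (0, indicatorConstLp 2 hS hSμ v)) (a - h)
      ⟨by linarith [ha.1], by linarith [ha.2]⟩
    have h2 : lyapunovIntegral A₁ h U (indicatorConstLp 2 hS hSμ v) a
        = ∫ s in S, complexAction (U a (h + s) * A₁ (h + s)) v ∂(delayMeasure h) := by
      rw [← integral_indicator hS]
      refine integral_congr_ae ?_
      filter_upwards [indicatorConstLp_coeFn (p := 2) (hs := hS) (hμs := hSμ) (c := v)] with s hs
      rw [hs]
      by_cases hsS : s ∈ S <;> simp [hsS]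
    have hint : Integrable (fun s => complexAction (U a (h + s) * A₁ (h + s)) v)
        ((delayMeasure h).restrict S) :=
      Integrable.integrableOn (μ := delayMeasure h) hker.continuousOn.integrableOn_Icc
    rw [ContinuousLinearMap.integral_comp_comm _ hint, ← h2]
    simpa [lyapunovSnd] using h1
  have hEq := Measure.eqOn_Icc_of_ae_eq (μ := volume) (by linarith : (-h) ≠ 0) hae
    hf.continuousOn continuousOn_const
    (⟨by linarith [hb.1], by linarith [hb.2]⟩ : b - h ∈ Set.Icc (-h) 0)
  have : f (b - h) = 0 := hEq
  simpa [f, complexAction_mul] using this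

end Extraction

theorem mainTheorem7 {n : ℕ} (A₀ A₁ : ℝ → Matrix (Fin n) (Fin n) ℝ) (h T : ℝ)
    (hh : 0 ≤ h) (hT : 0 < T) (hhT : h ≤ T)
    (hA₀ : Continuous A₀) (hA₁ : Continuous A₁)
    (hA₀T : Function.Periodic A₀ T) (hA₁T : Function.Periodic A₁ T)
    (U : ℝ → ℝ → Matrix (Fin n) (Fin n) ℝ)
    (hU : IsDelayLyapunovMatrix A₀ A₁ h T (fun _ => 0) U)
    (hP : ∀ φ : DelayStateSpace n h, lyapunovOperator A₁ h U hA₁ hU.continuous φ = 0) :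
    ∀ θ s : ℝ, U θ s = 0 := by
  refine hU.eq_zero_of_nonpos hT ?_
  have h0 := eq_zero_of_lyapunovOperator_eq_zero hP
  rcases hh.eq_or_lt with rfl | hpos
  · exact hU.eq_zero_of_delay_eq_zero hA₀ hA₁ h0
  · exact hU.eq_zero_of_delay_pos hpos hA₀ h0
      (transpose_mul_eq_zero_of_lyapunovOperator_eq_zero hpos hP)
      (transpose_mul_mul_eq_zero_of_lyapunovOperator_eq_zero hpos hP)
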